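/- Let $R$ be an associative ring with identity; modules are left $R$-modules unless stated otherwise, $\mathcal P$ is the class of projective modules, and $M^+=\mathrm{Hom}_{\mathbb Z}(M,\mathbb Q/\mathbb Z)$ denotes the character module. Let $\mathcal L$ be a class of left and $\mathcal A$ a class of right $R$-modules such that $(\mathcal L,\mathcal A)$ is a complete duality pair, that is: - a left module $M$ is in $\mathcal L$ if and only if $M^+\in\mathcal A$, and a right module $N$ is in $\mathcal A$ if and only if $N^+\in\mathcal L$; - $\mathcal L$ and $\mathcal A$ are closed under direct summands and finite direct sums; - $\mathcal L$ contains ${}_RR$ and is closed under arbitrary direct sums and extensions. A module $G$ is called strongly Gorenstein $(\mathcal L,\mathcal A)$-projective if there are a projective module $P$ and an endomorphism $f$ of $P$ such that $G\cong\ker f$, the sequence $\cdots\to P\xrightarrow{f}P\xrightarrow{f}P\to\cdots$ is exact, and it remains exact after applying $\mathrm{Hom}_R(-,L)$ for every $L\in\mathcal L$. For a class $\mathcal X$ of modules put $\mathcal X^\perp=\{B\mid \mathrm{Ext}^1_R(X,B)=0\ \forall X\in\mathcal X\}$ and ${}^\perp\mathcal X=\{B\mid \mathrm{Ext}^1_R(B,X)=0\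 \forall X\in\mathcal X\}$, and let $G^\perp=\{G\}^\perp$. A class of modules is thick if it is closed under direct summands, extensions, kernels of epimorphisms and cokernels of monomorphisms. A pair $(\mathcal X,\mathcal Y)$ of classes of modules is a cotorsion pair if $\mathcal X^\perp=\mathcal Y$ and $\mathcal X={}^\perp\mathcal Y$; it is complete if moreover every module $M$ admits exact sequences $0\to Y\to X\to M\to 0$ and $0\to M\to Y'\to X'\to 0$ with $X,X'\in\mathcal X$ and $Y,Y'\in\mathcal Y$. A complete cotorsion pair $(\mathcal X,\mathcal Y)$ is projective if $\mathcal Y$ is thick and $\mathcal X\cap\mathcal Y=\mathcal P$. A cotorsion pair $(\mathcal X,\mathcal Y)$ is cogenerated by a set $\mathcal S$ of modules if $\mathcal Y=\mathcal S^\perp$. **Proposition 4.4.** Let $G$ be a strongly Gorenstein $(\mathcal L,\mathcal A)$-projective module. Then: 1. $G^\perp$ is thick; 2. $({}^\perp(G^\perp),G^\perp)$ is a projective cotorsion pair, cogenerated by the set $\{G\}$. -/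

import Mathlib

open CategoryTheory

universe u v w

namespace StronglyGorenstein

/-! ### Thick classes and cotorsion pairs in an abelian category -/

section Abelian

variable {C : Type u} [Category.{v} C] [Abelian C]

/-- A class of objects of an abelian category is thick if it is closed under direct summands,
extensions, kernels of epimorphisms and cokernels of monomorphisms. -/
structure IsThick (X : ObjectProperty C) : Prop where
  directSummands : X.IsStableUnderRetracts
  extensions : X.IsClosedUnderExtensions
  kernels_of_epi : ∀ S : ShortComplex C, S.ShortExact → X S.X₂ → X S.X₃ → X S.X₁
  cokernels_of_mono : ∀ S : ShortComplex C, S.ShortExact → X S.X₁ → X S.X₂ → X S.X₃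

variable [HasExt.{w} C]

/-- The class `X^⊥` of all objects `B` such that `Ext¹(A, B) = 0` for all `A` in `X`. -/
def rightPerp (X : ObjectProperty C) : ObjectProperty C :=
  fun B => ∀ A : C, X A → Subsingleton (Abelian.Ext.{w} A B 1)

/-- The class `^⊥Y` of all objects `A` such that `Ext¹(A, B) = 0` for all `B` in `Y`. -/
def leftPerp (Y : ObjectProperty C) : ObjectProperty C :=
  fun A => ∀ B : C, Y B → Subsingleton (Abelian.Ext.{w} A B 1)

/-- The class `G^⊥` of all objects `B` such that `Ext¹(G, B) = 0`, for a single object `G`. -/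
def objPerp (G : C) : ObjectProperty C :=
  fun B => Subsingleton (Abelian.Ext.{w} G B 1)

/-- `(X, Y)` is a cotorsion pair. -/
structure IsCotorsionPair (X Y : ObjectProperty C) : Prop where
  rightPerp_eq : rightPerp X = Y
  leftPerp_eq : X = leftPerp Y

/-- `(X, Y)` is a cotorsion pair with enough projectives and enough injectives. -/
structure IsCompleteCotorsionPair (X Y : ObjectProperty C) : Prop
    extends IsCotorsionPair X Y where
  /-- every `A` fits in an exact sequence `0 ⟶ B ⟶ D ⟶ A ⟶ 0`, `B` in `Y` and `D` in `X` -/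
  enough_projectives : ∀ A : C, ∃ (B D : C) (i : B ⟶ D) (p : D ⟶ A) (h : i ≫ p = 0),
    Y B ∧ X D ∧ (ShortComplex.mk i p h).ShortExact
  /-- every `A` fits in an exact sequence `0 ⟶ A ⟶ B ⟶ D ⟶ 0`, `B` in `Y` and `D` in `X` -/
  enough_injectives : ∀ A : C, ∃ (B D : C) (i : A ⟶ B) (p : B ⟶ D) (h : i ≫ p = 0),
    Y B ∧ X D ∧ (ShortComplex.mk i p h).ShortExact

/-- A complete cotorsion pair `(X, Y)` is projective if `Y` is thick and the objects lying in
both `X` and `Y` are exactly the projective objects. -/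
structure IsProjectiveCotorsionPair (X Y : ObjectProperty C) : Prop
    extends IsCompleteCotorsionPair X Y where
  thick : IsThick Y
  inter_iff_projective : ∀ A : C, (X A ∧ Y A) ↔ Projective A

/-- The cotorsion pair `(X, Y)` is cogenerated by the class `S` of objects: `Y = S^⊥`
(and hence `X = ^⊥(S^⊥)`). -/
def IsCogeneratedBy (X Y : ObjectProperty C) (S : ObjectProperty C) : Prop :=
  IsCotorsionPair X Y ∧ Y = rightPerp S

end Abelian

/-! ### Duality pairs and strongly Gorenstein projective modules -/

/-- For a ring homomorphism `φ : T → Sᵐᵒᵖ` and a left `S`-module `M`, the `T`-module structure on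
`Hom_ℤ(M, ℚ/ℤ)` given by `(t • f) m = f (φ t • m)`. -/
@[reducible] def characterModuleStructure {S T : Type u} [Ring S] [Ring T] (φ : T →+* Sᵐᵒᵖ)
    (M : Type u) [AddCommGroup M] [Module S M] : Module T (M →+ AddCircle (1 : ℚ)) where
  smul t f := f.comp (DistribSMul.toAddMonoidHom M (φ t).unop)
  one_smul f := by
    ext m
    change f ((φ 1).unop • m) = f m
    simp
  mul_smul s t f := by
    ext m
    change f ((φ (s * t)).unop • m) = f ((φ t).unop • (φ s).unop • m)
    simp [mul_smul]
  smul_zero t := rfl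
  smul_add t f g := rfl
  add_smul s t f := by
    ext m
    change f ((φ (s + t)).unop • m) = f ((φ s).unop • m) + f ((φ t).unop • m)
    simp [add_smul]
  zero_smul f := by
    ext m
    change f ((φ 0).unop • m) = 0
    simp

/-- The character module `Hom_ℤ(M, ℚ/ℤ)`, with the module structure just described. -/
def characterModule {S T : Type u} [Ring S] [Ring T] (φ : T →+* Sᵐᵒᵖ)
    (M : ModuleCat.{u} S) : ModuleCat.{u} T :=
  letI := characterModuleStructure φ M
  ModuleCat.of T (M →+ AddCircle (1 : ℚ))

variable {R : Type u} [Ring R]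

/-- The character module `M⁺` of a left `R`-module `M`, a right `R`-module (i.e. a left module
over the opposite ring) with `(f • r) m = f (r • m)`. -/
def plusOfLeft (M : ModuleCat.{u} R) : ModuleCat.{u} Rᵐᵒᵖ :=
  characterModule (RingHom.id Rᵐᵒᵖ) M

/-- The character module `N⁺` of a right `R`-module `N`, a left `R`-module with
`(r • f) n = f (n • r)`. -/
def plusOfRight (N : ModuleCat.{u} Rᵐᵒᵖ) : ModuleCat.{u} R :=
  characterModule (RingEquiv.opOp R).toRingHom N

/-- `(L, A)` is a duality pair with respect to the character module construction `plus`: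
`M` is in `L` iff `M⁺` is in `A`, and `A` is closed under direct summands and finite
direct sums. -/
structure IsDualityPair {S T : Type u} [Ring S] [Ring T]
    (plus : ModuleCat.{u} S → ModuleCat.{u} T)
    (L : ObjectProperty (ModuleCat.{u} S)) (A : ObjectProperty (ModuleCat.{u} T)) : Prop where
  mem_iff : ∀ M, L M ↔ A (plus M)
  directSummands : A.IsStableUnderRetracts
  finiteDirectSums : A.IsClosedUnderFiniteCoproducts

/-- A complete duality pair over `R`: `(L, A)` and `(A, L)` are both duality pairs, and `L`
contains `R` and is closed under arbitrary direct sums and extensions. -/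
structure IsCompleteDualityPair (L : ObjectProperty (ModuleCat.{u} R))
    (A : ObjectProperty (ModuleCat.{u} Rᵐᵒᵖ)) : Prop where
  dualityPair : IsDualityPair plusOfLeft L A
  dualityPair_symm : IsDualityPair plusOfRight A L
  self_mem : L (ModuleCat.of R R)
  coproducts : ∀ ι : Type u, L.IsClosedUnderColimitsOfShape (Discrete ι)
  extensions : L.IsClosedUnderExtensions

/-- `M` is strongly Gorenstein `(L, A)`-projective (the second class plays no role in the
definition): there are a projective module `P` and an endomorphism `f` of `P` such that the
periodic sequence `⋯ ⟶ P ⟶ P ⟶ P ⟶ ⋯` with all maps equal to `f` is exact, stays exact after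
applying `Hom_R(-, N)` for every `N` in `L`, and `M ≅ ker f`. -/
def IsStronglyGorensteinProjective (L : ObjectProperty (ModuleCat.{u} R))
    (M : ModuleCat.{u} R) : Prop :=
  ∃ (P : ModuleCat.{u} R) (f : P →ₗ[R] P),
    Module.Projective R P ∧
    Function.Exact f f ∧
    (∀ N : ModuleCat.{u} R, L N →
      Function.Exact (fun g : P →ₗ[R] N => g ∘ₗ f) (fun g : P →ₗ[R] N => g ∘ₗ f)) ∧
    Nonempty (M ≃ₗ[R] LinearMap.ker f)

end StronglyGorenstein

/-!
The defining complex of a strongly Gorenstein `(L, A)`-projective module `G` breaks up into copies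
of one exact sequence `0 ⟶ G ⟶ P ⟶ G ⟶ 0` with `P` projective, for which every morphism from `G`
to a module in `L` extends to `P` (`IsStronglyGorensteinProjective.exists_shortExact`). Three facts
follow.

* By dimension shifting, `Ext¹(G, B) = 0` if and only if `Ext²(G, B) = 0`, and the long exact
  sequence makes `G^⊥` thick (`isThick_objPerp`).
* The class `L` contains `R` and is closed under coproducts and direct summands, so it contains
  all projective modules (`prop_of_projective`); the extension property then puts them in `G^⊥`.
* The cotorsion pair `(^⊥(G^⊥), G^⊥)` is complete. This holds for any object `G` with a projective
  presentation `0 ⟶ K ⟶ P ⟶ G ⟶ 0` in a Grothendieck abelian category with a projective separator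
  `U` (`isCompleteCotorsionPair_leftPerp_objPerp`). The morphisms with the right lifting property
  with respect to the single monomorphism `K ⟶ P ⊞ U` are the epimorphisms with kernel in `G^⊥`,
  and the monomorphisms in the left class they determine have cokernel in `^⊥(G^⊥)`. The small
  object argument factors `0 ⟶ A` and `A ⟶ 0`, which gives the two approximation sequences of `A`.

A complete cotorsion pair whose right class is thick and contains the projective objects is
projective (`isProjectiveCotorsionPair_of_isThick`).
-/

universe t

namespace StronglyGorenstein

open Limits ZeroObject Abelian MorphismProperty

section Abelian

/-! ### Vanishing of `Ext¹` and the classes `G^⊥` -/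

variable {C : Type u} [Category.{v} C] [Abelian C] [HasExt.{w} C]

lemma subsingleton_ext_one_iff_of_projective {S : ShortComplex C} (hS : S.ShortExact)
    [Projective S.X₂] (B : C) :
    Subsingleton (Ext.{w} S.X₃ B 1) ↔
      ∀ g : S.X₁ ⟶ B, ∃ h : S.X₂ ⟶ B, S.f ≫ h = g := by
  constructor
  · intro _ g
    obtain ⟨x, hx⟩ := Ext.contravariant_sequence_exact₁ hS B (Ext.mk₀ g) (add_zero 1)
      (Subsingleton.elim _ _)
    obtain ⟨h, rfl⟩ := (Ext.mk₀_bijective _ _).2 x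
    rw [Ext.mk₀_comp_mk₀] at hx
    exact ⟨h, (Ext.mk₀_bijective _ _).1 hx⟩
  · intro H
    refine subsingleton_of_forall_eq 0 fun x ↦ ?_
    obtain ⟨y, rfl⟩ := Ext.contravariant_sequence_exact₃ hS B x
      (Ext.eq_zero_of_projective _) (add_zero 1)
    obtain ⟨g, rfl⟩ := (Ext.mk₀_bijective _ _).2 y
    obtain ⟨h, rfl⟩ := H g
    rw [← Ext.mk₀_comp_mk₀, ShortComplex.ShortExact.extClass_comp_assoc]

lemma subsingleton_ext_one_of_injective {S : ShortComplex C} (hS : S.ShortExact)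
    [Injective S.X₂] (A : C) (H : ∀ g : A ⟶ S.X₃, ∃ h : A ⟶ S.X₂, h ≫ S.g = g) :
    Subsingleton (Ext.{w} A S.X₁ 1) := by
  refine subsingleton_of_forall_eq 0 fun x ↦ ?_
  obtain ⟨y, rfl⟩ := Ext.covariant_sequence_exact₁ A hS x
    (Ext.eq_zero_of_injective _) (zero_add 1)
  obtain ⟨g, rfl⟩ := (Ext.mk₀_bijective _ _).2 y
  obtain ⟨h, rfl⟩ := H g
  rw [← Ext.mk₀_comp_mk₀, Ext.comp_assoc_of_second_deg_zero,
    ShortComplex.ShortExact.comp_extClass, Ext.comp_zero]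

lemma exists_section_of_subsingleton_ext {S : ShortComplex C} (hS : S.ShortExact)
    (h : Subsingleton (Ext.{w} S.X₃ S.X₁ 1)) : ∃ s : S.X₃ ⟶ S.X₂, s ≫ S.g = 𝟙 _ := by
  obtain ⟨x, hx⟩ := Ext.covariant_sequence_exact₃ S.X₃ hS (Ext.mk₀ (𝟙 _)) (zero_add 1)
    (Subsingleton.elim _ _)
  obtain ⟨s, rfl⟩ := (Ext.mk₀_bijective _ _).2 x
  rw [Ext.mk₀_comp_mk₀] at hx
  exact ⟨s, (Ext.mk₀_bijective _ _).1 hx⟩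

instance isStableUnderRetracts_objPerp (G : C) : (objPerp G).IsStableUnderRetracts where
  of_retract {X Y} r (_ : Subsingleton _) := by
    refine subsingleton_of_forall_eq 0 fun x ↦ ?_
    have h : (x.comp (Ext.mk₀ r.i) (add_zero 1)).comp (Ext.mk₀ r.r) (add_zero 1) = x := by
      rw [Ext.comp_assoc_of_third_deg_zero, Ext.mk₀_comp_mk₀, r.retract, Ext.comp_mk₀_id]
    rw [← h, Subsingleton.elim (x.comp (Ext.mk₀ r.i) (add_zero 1)) 0, Ext.zero_comp]

instance isClosedUnderExtensions_objPerp (G : C) :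
    (objPerp G).IsClosedUnderExtensions where
  prop_X₂_of_shortExact {S} hS (_ : Subsingleton _) (_ : Subsingleton _) := by
    refine subsingleton_of_forall_eq 0 fun x ↦ ?_
    obtain ⟨y, rfl⟩ := Ext.covariant_sequence_exact₂ G hS x (Subsingleton.elim _ _)
    rw [Subsingleton.elim y 0, Ext.zero_comp]

/-! ### Thickness of `G^⊥` for a periodic object `G` -/

section Periodic

variable {G P : C} {i : G ⟶ P} {p : P ⟶ G} {w : i ≫ p = 0}
  (hS : (ShortComplex.mk i p w).ShortExact) [Projective P]

include hS

lemma objPerp_iff_subsingleton_ext_two (B : C) :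
    objPerp G B ↔ Subsingleton (Ext.{w} G B 2) := by
  constructor
  · intro (_ : Subsingleton _)
    refine subsingleton_of_forall_eq 0 fun x ↦ ?_
    obtain ⟨y, rfl⟩ := Ext.contravariant_sequence_exact₃ hS B x
      (Ext.eq_zero_of_projective (P := P) _) (n₀ := 1) rfl
    rw [Subsingleton.elim y 0, Ext.comp_zero]
  · intro _
    refine subsingleton_of_forall_eq 0 fun x ↦ ?_
    obtain ⟨y, rfl⟩ := Ext.contravariant_sequence_exact₁ hS B x (n₁ := 2) rfl
      (Subsingleton.elim (α := Ext.{w} G B 2) _ _)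
    rw [Ext.eq_zero_of_projective (P := P) y, Ext.comp_zero]

/-- If there is an exact sequence `0 ⟶ G ⟶ P ⟶ G ⟶ 0` with `P` projective, then `G^⊥` is thick:
`Ext¹(G, -)` and `Ext²(G, -)` vanish on the same objects, so the two missing closure properties
can be read off from the long exact sequence. -/
lemma isThick_objPerp : IsThick (objPerp G) where
  directSummands := inferInstance
  extensions := inferInstance
  kernels_of_epi T hT h₂ h₃ := by
    have := (objPerp_iff_subsingleton_ext_two hS _).1 h₂
    have : Subsingleton _ := h₃
    rw [objPerp_iff_subsingleton_ext_two hS]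
    refine subsingleton_of_forall_eq 0 fun x ↦ ?_
    obtain ⟨y, rfl⟩ := Ext.covariant_sequence_exact₁ G hT x (Subsingleton.elim _ _)
      (n₀ := 1) rfl
    rw [Subsingleton.elim y 0, Ext.zero_comp]
  cokernels_of_mono T hT h₁ h₂ := by
    have := (objPerp_iff_subsingleton_ext_two hS _).1 h₁
    have : Subsingleton _ := h₂
    refine subsingleton_of_forall_eq 0 fun x ↦ ?_
    obtain ⟨y, rfl⟩ := Ext.covariant_sequence_exact₃ G hT x (n₁ := 2) rfl
      (Subsingleton.elim _ _)
    rw [Subsingleton.elim y 0, Ext.zero_comp]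

end Periodic

/-! ### Cotorsion pairs and lifting properties -/

lemma isCotorsionPair_leftPerp_objPerp (G : C) :
    IsCotorsionPair (leftPerp (objPerp G)) (objPerp G) where
  rightPerp_eq := by
    ext B
    exact ⟨fun hB ↦ hB G fun _ h ↦ h, fun hB A hA ↦ hA B hB⟩
  leftPerp_eq := rfl

lemma objPerp_eq_rightPerp_singleton (G : C) :
    objPerp G = rightPerp (ObjectProperty.singleton G) := by
  ext B
  simp [objPerp, rightPerp]

/-- The morphism `K ⟶ P ⊞ U` obtained from `S : 0 ⟶ K ⟶ P ⟶ G ⟶ 0`. For `P` projective and `U` a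
projective separator, the morphisms with the right lifting property with respect to it are exactly
the epimorphisms with kernel in `G^⊥`; the summand `U` is what forces them to be epimorphisms. -/
noncomputable abbrev generatingMorphism (S : ShortComplex C) (U : C) : S.X₁ ⟶ S.X₂ ⊞ U :=
  S.f ≫ biprod.inl

omit [HasExt.{w} C] in
lemma epi_of_rlp_generatingMorphism (S : ShortComplex C) {U : C} (hU : IsSeparator U)
    {X Y : C} {q : X ⟶ Y} (hq : (single (generatingMorphism S U)).rlp q) : Epi q := by
  rw [Preadditive.epi_iff_cancel_zero]
  intro Z g hg
  refine (Preadditive.isSeparator_iff U).1 hU g fun y ↦ ?_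
  have := hq _ ⟨()⟩
  have sq : CommSq (0 : S.X₁ ⟶ X) (generatingMorphism S U) q (biprod.desc 0 y) := ⟨by simp⟩
  have h : biprod.inr ≫ sq.lift ≫ q = y := by simp
  rw [← h, Category.assoc, Category.assoc, hg, comp_zero, comp_zero]

lemma objPerp_of_rlp {S : ShortComplex C} (hS : S.ShortExact) [Projective S.X₂] (U : C)
    {T : ShortComplex C} (hT : T.Exact) [Mono T.f]
    (hq : (single (generatingMorphism S U)).rlp T.g) : objPerp S.X₃ T.X₁ := by
  rw [objPerp, subsingleton_ext_one_iff_of_projective hS]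
  intro g
  have := hq _ ⟨()⟩
  have sq : CommSq (g ≫ T.f) (generatingMorphism S U) T.g 0 := ⟨by simp⟩
  refine ⟨hT.lift (biprod.inl ≫ sq.lift) (by simp), ?_⟩
  rw [← cancel_mono T.f, Category.assoc, hT.lift_f, ← Category.assoc, sq.fac_left]

lemma rlp_generatingMorphism {S : ShortComplex C} (hS : S.ShortExact) [Projective S.X₂] (U : C)
    [Projective U] {T : ShortComplex C} (hT : T.ShortExact) (h : objPerp S.X₃ T.X₁) :
    (single (generatingMorphism S U)).rlp T.g := by
  have := hT.mono_f
  have := hT.epi_g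
  rintro _ _ _ ⟨⟩
  refine ⟨fun {a b} sq ↦ ?_⟩
  -- Projectivity gives a lift `l` of `b`; it is corrected by an extension along `S.f` of the
  -- defect, a morphism with values in the kernel `T.X₁`.
  let l := Projective.factorThru b T.g
  have hl : (a - generatingMorphism S U ≫ l) ≫ T.g = 0 := by
    rw [Preadditive.sub_comp, Category.assoc, Projective.factorThru_comp, sq.w, sub_self]
  obtain ⟨e, he⟩ := (subsingleton_ext_one_iff_of_projective hS _).1 h (hT.exact.lift _ hl)
  refine ⟨⟨⟨biprod.fst ≫ e ≫ T.f + l, ?_, ?_⟩⟩⟩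
  · have h' : S.f ≫ e ≫ T.f = a - generatingMorphism S U ≫ l := by
      rw [← Category.assoc, he, hT.exact.lift_f]
    rw [Preadditive.comp_add, Category.assoc, biprod.inl_fst_assoc, h', sub_add_cancel]
  · rw [Preadditive.add_comp, Category.assoc, Category.assoc, T.zero, comp_zero, comp_zero,
      zero_add, Projective.factorThru_comp]

/-! ### The small object argument -/

section Grothendieck

variable [IsGrothendieckAbelian.{t} C]

omit [HasExt.{w} C] in
/-- The source `K` of `j` is small relative to transfinite compositions of monomorphisms, by the
cardinality of its set of subobjects, and cell attachments along `j` are monomorphisms. -/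
lemma hasSmallObjectArgument_single_of_mono {K Q : C} (j : K ⟶ Q) [Mono j] :
    HasSmallObjectArgument.{t} (single j) := by
  obtain ⟨κ, hκ', hκ⟩ := HasCardinalLT.exists_regular_cardinal.{t} (Subobject K)
  have : Fact κ.IsRegular := ⟨hκ'⟩
  have : Nonempty κ.ord.ToType := by simpa using hκ'.ne_zero
  have := WellFoundedLT.toOrderBot κ.ord.ToType
  have : IsSmall.{t} (single j) := isSmall_ofHoms ..
  exact ⟨κ, inferInstance, inferInstance,
    { preservesColimit {A B X Y} i hi f hf := by
        let hf' : (monomorphisms C).TransfiniteCompositionOfShape κ.ord.ToType f :=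
          { toTransfiniteCompositionOfShape := hf.toTransfiniteCompositionOfShape
            map_mem k hk := by
              have := (hf.attachCells k hk).pushouts_coproducts
              simp only [ofHoms_homFamily] at this
              refine (?_ : _ ≤ monomorphisms C) _ this
              simp only [pushouts_le_iff, coproducts_le_iff]
              rintro _ _ _ ⟨⟩
              exact monomorphisms.infer_property _ }
        have (k k' : κ.ord.ToType) (φ : k ⟶ k') : Mono (hf'.F.map φ) := hf'.mem_map φ
        obtain ⟨⟩ := hi
        exact IsGrothendieckAbelian.preservesColimit_coyoneda_obj_of_mono
          (Y := hf'.F) (κ := κ) hκ }⟩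

omit [HasExt.{w} C] in
/-- In a Grothendieck abelian category the monomorphisms are the left class of a weak factorization
system, so they contain the left class generated by any monomorphism. -/
lemma mono_of_llp_rlp_single {K Q : C} (j : K ⟶ Q) [Mono j] {A B : C} {i : A ⟶ B}
    (hi : (single j).rlp.llp i) : Mono i := by
  have h : single j ≤ monomorphisms C := by
    rintro _ _ _ ⟨⟩
    exact monomorphisms.infer_property _
  have := antitone_llp (antitone_rlp h) _ hi
  rwa [IsGrothendieckAbelian.llp_rlp_monomorphisms (isSeparator_separator C)] at this

omit [IsGrothendieckAbelian.{t} C] in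
/-- The cokernel of a morphism in the left class of the small object argument belongs to
`^⊥(S.X₃^⊥)`. Eklof's lemma is not needed for this: an object `Y` of `S.X₃^⊥` is embedded in an
injective `J`; then `J ⟶ J/Y` is in the right class, so every morphism from the cokernel to `J/Y`
lifts to `J`, and `Ext¹(-, J) = 0`. -/
lemma leftPerp_of_llp_rlp [EnoughInjectives C] {S : ShortComplex C} (hS : S.ShortExact)
    [Projective S.X₂] (U : C) [Projective U] {T : ShortComplex C} (hT : T.Exact) [Epi T.g]
    (hi : (single (generatingMorphism S U)).rlp.llp T.f) :
    leftPerp (objPerp S.X₃) T.X₃ := by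
  intro Y hY
  let E := ShortComplex.mk (Injective.ι Y) (cokernel.π (Injective.ι Y)) (cokernel.condition _)
  have hE : E.ShortExact :=
    { exact := ShortComplex.exact_cokernel _
      mono_f := inferInstanceAs (Mono (Injective.ι Y))
      epi_g := inferInstanceAs (Epi (cokernel.π _)) }
  have : Injective E.X₂ := inferInstanceAs (Injective (Injective.under Y))
  refine subsingleton_ext_one_of_injective hE _ fun g ↦ ?_
  have := hi _ (rlp_generatingMorphism hS U hE hY)
  have sq : CommSq (0 : T.X₁ ⟶ E.X₂) T.f E.g (T.g ≫ g) := ⟨by simp⟩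
  refine ⟨hT.desc sq.lift sq.fac_left, ?_⟩
  rw [← cancel_epi T.g, ← Category.assoc, hT.g_desc, sq.fac_right]

/-- In a Grothendieck abelian category with a projective separator, a projective presentation
`0 ⟶ K ⟶ P ⟶ G ⟶ 0` yields the completeness of the cotorsion pair cogenerated by `G`: the two
approximation sequences of `A` come from factoring `0 ⟶ A` and `A ⟶ 0`. -/
lemma isCompleteCotorsionPair_leftPerp_objPerp {S : ShortComplex C} (hS : S.ShortExact)
    [Projective S.X₂] {U : C} [Projective U] (hU : IsSeparator U) :
    IsCompleteCotorsionPair (leftPerp (objPerp S.X₃)) (objPerp S.X₃) := by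
  have := hS.mono_f
  have := hasSmallObjectArgument_single_of_mono.{u, v, t} (generatingMorphism S U)
  let j := single (generatingMorphism S U)
  refine { isCotorsionPair_leftPerp_objPerp S.X₃ with
    enough_projectives := fun A ↦ ?_
    enough_injectives := fun A ↦ ?_ }
  · let F := factorizationData j.rlp.llp j.rlp (0 : 0 ⟶ A)
    have := epi_of_rlp_generatingMorphism S hU F.hp
    have hF : F.i = 0 := (isZero_zero C).eq_of_src _ _
    let T := ShortComplex.mk F.i (𝟙 F.Z) (by simp [hF])
    have hT : T.Exact := (T.exact_iff_mono hF).2 (inferInstanceAs (Mono (𝟙 F.Z)))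
    have : Epi T.g := inferInstanceAs (Epi (𝟙 F.Z))
    have hK := ShortComplex.exact_kernel F.p
    exact ⟨kernel F.p, F.Z, kernel.ι F.p, F.p, kernel.condition _,
      objPerp_of_rlp hS U (T := ShortComplex.mk _ _ (kernel.condition F.p)) hK F.hp,
      leftPerp_of_llp_rlp hS U hT F.hi, { exact := hK }⟩
  · let F := factorizationData j.rlp.llp j.rlp (0 : A ⟶ 0)
    have := mono_of_llp_rlp_single.{u, v, t} _ F.hi
    have hF : F.p = 0 := (isZero_zero C).eq_of_tgt _ _
    let T := ShortComplex.mk (𝟙 F.Z) F.p (by simp [hF])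
    have hT : T.Exact := (T.exact_iff_epi hF).2 (inferInstanceAs (Epi (𝟙 F.Z)))
    have : Mono T.f := inferInstanceAs (Mono (𝟙 F.Z))
    have hK := ShortComplex.exact_cokernel F.i
    exact ⟨F.Z, cokernel F.i, F.i, cokernel.π F.i, cokernel.condition _,
      objPerp_of_rlp hS U hT F.hp,
      leftPerp_of_llp_rlp hS U (T := ShortComplex.mk _ _ (cokernel.condition F.i)) hK F.hi,
      { exact := hK }⟩

end Grothendieck

/-! ### Projective cotorsion pairs -/

/-- A complete cotorsion pair `(X, Y)` with `Y` thick is projective as soon as `Y` contains the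
projective objects: if `A` is in `X ∩ Y`, the kernel of an epimorphism from a projective object
onto `A` is in `Y` by thickness, so this epimorphism splits. -/
lemma isProjectiveCotorsionPair_of_isThick [EnoughProjectives C] {X Y : ObjectProperty C}
    (h : IsCompleteCotorsionPair X Y) (hY : IsThick Y) (hP : ∀ P : C, Projective P → Y P) :
    IsProjectiveCotorsionPair X Y := by
  refine { h with
    thick := hY
    inter_iff_projective := fun A ↦ ⟨fun ⟨hXA, hYA⟩ ↦ ?_, fun hA ↦ ⟨?_, hP A hA⟩⟩ }
  · let T := ShortComplex.mk (kernel.ι (Projective.π A)) (Projective.π A) (kernel.condition _)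
    have hT : T.ShortExact :=
      { exact := ShortComplex.exact_kernel _
        mono_f := inferInstanceAs (Mono (kernel.ι _))
        epi_g := inferInstanceAs (Epi (Projective.π A)) }
    have hK := hY.kernels_of_epi T hT (hP _ (inferInstanceAs (Projective (Projective.over A)))) hYA
    rw [h.leftPerp_eq] at hXA
    obtain ⟨s, hs⟩ := exists_section_of_subsingleton_ext hT (hXA _ hK)
    exact (Retract.mk s T.g hs).projective (p := inferInstanceAs (Projective (Projective.over A)))
  · rw [h.leftPerp_eq]
    exact fun B _ ↦ Ext.subsingleton_of_projective A B 0

end Abelian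

/-! ### Strongly Gorenstein projective modules -/

section Modules

variable {R : Type u} [Ring R]

variable (R) in
lemma isSeparator_moduleCat_self : IsSeparator (ModuleCat.of R R) :=
  fun X Y f g h ↦ by
    ext x
    simpa using ConcreteCategory.congr_hom
      (h _ (by simp) (ModuleCat.ofHom (LinearMap.toSpanSingleton R X x))) 1

/-- A projective module is a direct summand of a coproduct of copies of `R`. -/
lemma prop_of_projective {L : ObjectProperty (ModuleCat.{u} R)} [L.IsStableUnderRetracts]
    (hR : L (ModuleCat.of R R)) (hL : ∀ ι : Type u, L.IsClosedUnderColimitsOfShape (Discrete ι))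
    (P : ModuleCat.{u} R) [Projective P] : L P := by
  have := hL (ModuleCat.of R R ⟶ P)
  have : Epi (Sigma.desc fun f : ModuleCat.of R R ⟶ P ↦ f) :=
    (isSeparator_iff_epi _).1 (isSeparator_moduleCat_self R) P
  exact L.prop_of_retract
    ⟨Projective.factorThru (𝟙 P) (Sigma.desc fun f : ModuleCat.of R R ⟶ P ↦ f), _,
      Projective.factorThru_comp _ _⟩
    (L.prop_colimit _ fun _ ↦ hR)

/-- The periodic complex defining `M` breaks up into copies of a short exact sequence
`0 ⟶ M ⟶ P ⟶ M ⟶ 0`, and its exactness under `Hom(-, N)` lets every morphism `M ⟶ N` extend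
to `P`. -/
lemma IsStronglyGorensteinProjective.exists_shortExact {L : ObjectProperty (ModuleCat.{u} R)}
    {M : ModuleCat.{u} R} (hM : IsStronglyGorensteinProjective L M) :
    ∃ (P : ModuleCat.{u} R) (i : M ⟶ P) (p : P ⟶ M) (w : i ≫ p = 0),
      Projective P ∧ (ShortComplex.mk i p w).ShortExact ∧
      ∀ N : ModuleCat.{u} R, L N → ∀ g : M ⟶ N, ∃ h : P ⟶ N, i ≫ h = g := by
  obtain ⟨P, f, hP, hf, hL, ⟨e⟩⟩ := hM
  let i₀ : M →ₗ[R] P := (LinearMap.ker f).subtype ∘ₗ e.toLinearMap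
  let p₀ : P →ₗ[R] M := e.symm.toLinearMap ∘ₗ f.codRestrict (LinearMap.ker f)
    fun x ↦ hf.apply_apply_eq_zero x
  have hip (x : P) : i₀ (p₀ x) = f x := by
    change ((e (e.symm _) : LinearMap.ker f) : P) = f x
    rw [e.apply_symm_apply]
    rfl
  have hi : Function.Injective i₀ := (Subtype.val_injective).comp e.injective
  have hp : Function.Surjective p₀ := fun m ↦ by
    obtain ⟨x, hx⟩ := (hf (i₀ m)).1 (e m).2
    exact ⟨x, hi (by rw [hip, hx])⟩
  have hpi (m : M) : p₀ (i₀ m) = 0 := hi (by rw [hip, map_zero]; exact (e m).2)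
  have w : ModuleCat.ofHom i₀ ≫ ModuleCat.ofHom p₀ = 0 := by
    ext m
    exact hpi m
  refine ⟨P, ModuleCat.ofHom i₀, ModuleCat.ofHom p₀, w,
    (IsProjective.iff_projective _).1 hP,
    { exact := (ShortComplex.moduleCat_exact_iff _).2 fun x hx ↦ ?_
      mono_f := (ModuleCat.mono_iff_injective _).2 hi
      epi_g := (ModuleCat.epi_iff_surjective _).2 hp }, fun N hN g ↦ ?_⟩
  · have hx' : f x = 0 := by rw [← hip, show p₀ x = 0 from hx, map_zero]
    exact ⟨e.symm ⟨x, hx'⟩, by simp [i₀]⟩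
  · obtain ⟨k, hk⟩ := (hL N hN (g.hom ∘ₗ p₀)).1 (by
      ext x
      change g.hom (p₀ (f x)) = 0
      rw [← hip, hpi, map_zero])
    refine ⟨ModuleCat.ofHom k, ?_⟩
    ext m
    obtain ⟨x, rfl⟩ := hp m
    change k (i₀ (p₀ x)) = g.hom (p₀ x)
    rw [hip]
    exact LinearMap.congr_fun hk x

end Modules

end StronglyGorenstein

theorem proposition4p4 {R : Type u} [Ring R]
    (L : ObjectProperty (ModuleCat.{u} R)) (A : ObjectProperty (ModuleCat.{u} Rᵐᵒᵖ))
    (hLA : StronglyGorenstein.IsCompleteDualityPair L A)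
    (G : ModuleCat.{u} R) (hG : StronglyGorenstein.IsStronglyGorensteinProjective L G) :
    StronglyGorenstein.IsThick (StronglyGorenstein.objPerp G) ∧
    StronglyGorenstein.IsProjectiveCotorsionPair
      (StronglyGorenstein.leftPerp (StronglyGorenstein.objPerp G))
      (StronglyGorenstein.objPerp G) ∧
    StronglyGorenstein.IsCogeneratedBy
      (StronglyGorenstein.leftPerp (StronglyGorenstein.objPerp G))
      (StronglyGorenstein.objPerp G)
      (ObjectProperty.singleton G) := by
  obtain ⟨P, i, p, w, hP, hS, hL⟩ := hG.exists_shortExact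
  have := hLA.dualityPair_symm.directSummands
  have : Projective (ShortComplex.mk i p w).X₂ := hP
  have hR : IsSeparator (ModuleCat.of R R) := StronglyGorenstein.isSeparator_moduleCat_self R
  have : Projective (ModuleCat.of R R) := (IsProjective.iff_projective _).1 inferInstance
  have hT := StronglyGorenstein.isThick_objPerp hS
  refine ⟨hT, StronglyGorenstein.isProjectiveCotorsionPair_of_isThick
    (StronglyGorenstein.isCompleteCotorsionPair_leftPerp_objPerp hS hR) hT fun Q _ ↦ ?_,
    StronglyGorenstein.isCotorsionPair_leftPerp_objPerp G,
    StronglyGorenstein.objPerp_eq_rightPerp_singleton G⟩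
  exact (StronglyGorenstein.subsingleton_ext_one_iff_of_projective hS Q).2
    (hL Q (StronglyGorenstein.prop_of_projective hLA.self_mem hLA.coproducts Q))
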